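/- Let $F:\mathbf{Set}\to\mathbf{Set}$ be a finitary functor (one preserving filtered colimits) with $F\emptyset\neq\emptyset$, and let $p\in F\emptyset$, regarded as a map $p:1\to F\emptyset$. Let $F^n0$ with connecting maps $w_{m,n}:F^m0\to F^n0$ be the initial-algebra chain ($F^00=\emptyset$, $F^{n+1}0=F(F^n0)$), with colimit $F^\omega0$ and injections $w_{n,\omega}$. Let $F^n1$ with connecting maps $v_{n,m}:F^n1\to F^m1$ ($n\ge m$) be the terminal-coalgebra chain ($F^01=1$, $F^{n+1}1=F(F^n1)$), with limit $F^\omega1$ and projections $v_{\omega,n}$. Let $\bar u:F^\omega0\to F^\omega1$ be the unique map with $v_{\omega,n}\cdot\bar u\cdot w_{n,\omega}=F^n!$ for all $n\in\mathbb N$, where $!:\emptyset\to1$, and put $$\varepsilon_n=\bar u\cdot w_{n+1,\omega}\cdot F^np\cdot v_{\omega,n}:F^\omega1\to F^\omega1 .$$ A cpo is a poset in which every nonempty directed subset has a join; a map between posets is continuous if it preserves all existing joins of nonempty directed subsets. A conservative completion of a poset $P$ is a cpo $\bar P$ containing $P$ as a subposet, with continuous inclusion, such that every continuous map from $P$ to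 a cpo has a unique continuous extension to $\bar P$. Then $F$ has an initial algebra $\iota:F(\mu F)\to\mu F$ and a terminal coalgebra $\tau:\nu F\to F(\nu F)$. Let $m:\mu F\to\nu F$ be the unique coalgebra homomorphism from $(\mu F,\iota^{-1})$ to $(\nu F,\tau)$, and $h:\nu F\to F^\omega1$ the canonical map, whose components $h_n=v_{\omega,n}\cdot h$ satisfy $h_{n+1}=Fh_n\cdot\tau$. Then: 1. The relation $t\sqsubseteq s$ iff $t=s$ or $t=\varepsilon_n(s)$ for some $n\in\mathbb N$ is a partial order on $F^\omega1$. The maps $h$ and $m$ are injective, so that $\nu F$ becomes a subposet of $F^\omega1$ via $h$, and $\mu F$ a subposet of $\nu F$ via $m$. 2. $F^\omega1$ is a conservative completion of $\nu F$ (via $h$) and also of $\mu F$ (via $h\cdot m$). Thus the conservative completions of $\mu F$ and $\nu F$ coincide. 3. Order $F(\nu F)$ and $F(\mu F)$ so that the bijections $\tau$ and $\iota$ are order isomorphisms. Then $F(\mu F)$ is a subposet of $F(\nu F)$ via $Fm$, the map $\iota^{-1}$ is continuous, and $\tau$ is the unique continuous extension of $\iota^{-1}$: it is the unique continuous map $g:\nu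 F\to F(\nu F)$ with $g\cdot m=Fm\cdot\iota^{-1}$. -/

import Mathlib

universe u

open CategoryTheory CategoryTheory.Limits

namespace SetFunctor

noncomputable section

/-- The finite stages `Fⁿ0` of the initial-algebra chain of a set functor. -/
def initChain (F : Type u ⥤ Type u) : ℕ → Type u
  | 0 => PEmpty.{u + 1}
  | n + 1 => F.obj (initChain F n)

/-- The connecting maps `w_{n,n+1} : Fⁿ0 ⟶ Fⁿ⁺¹0`. -/
def initChainMap (F : Type u ⥤ Type u) : ∀ n : ℕ, initChain F n ⟶ initChain F (n + 1)
  | 0 => ↾(fun x : PEmpty.{u + 1} => x.elim)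
  | n + 1 => F.map (initChainMap F n)

/-- The finite stages `Fⁿ1` of the terminal-coalgebra chain of a set functor. -/
def termChain (F : Type u ⥤ Type u) : ℕ → Type u
  | 0 => PUnit.{u + 1}
  | n + 1 => F.obj (termChain F n)

/-- The connecting maps `v_{n+1,n} : Fⁿ⁺¹1 ⟶ Fⁿ1`. -/
def termChainMap (F : Type u ⥤ Type u) : ∀ n : ℕ, termChain F (n + 1) ⟶ termChain F n
  | 0 => ↾(fun _ => PUnit.unit)
  | n + 1 => F.map (termChainMap F n)

/-- `F^ω 0`, the colimit of the finite stages of the initial-algebra chain. -/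
def OmegaColimit (F : Type u ⥤ Type u) : Type u :=
  colimit (Functor.ofSequence (initChainMap F))

/-- The colimit injections `w_{n,ω} : Fⁿ0 ⟶ F^ω 0`. -/
def initInj (F : Type u ⥤ Type u) (n : ℕ) : initChain F n ⟶ OmegaColimit F :=
  colimit.ι (Functor.ofSequence (initChainMap F)) n

/-- `F^ω 1`, the limit of the finite stages of the terminal-coalgebra chain. -/
def OmegaLimit (F : Type u ⥤ Type u) : Type u :=
  {x : ∀ n : ℕ, termChain F n // ∀ n, termChainMap F n (x (n + 1)) = x n}

/-- The limit projections `v_{ω,n} : F^ω 1 ⟶ Fⁿ1`. -/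
def termProj (F : Type u ⥤ Type u) (n : ℕ) : OmegaLimit F ⟶ termChain F n :=
  ↾(fun x => x.1 n)

/-- The canonical maps `Fᵐ0 ⟶ Fⁿ1`: the unique map `!` if `m = 0` or `n = 0`, and `F` applied to
the canonical map `Fᵐ0 ⟶ Fⁿ1` for `m + 1`, `n + 1`. On the diagonal it is `Fⁿ!`. -/
def cross (F : Type u ⥤ Type u) : ∀ m n : ℕ, initChain F m ⟶ termChain F n
  | 0, _ => ↾(fun x : PEmpty.{u + 1} => x.elim)
  | _ + 1, 0 => ↾(fun _ => PUnit.unit)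
  | m + 1, n + 1 => F.map (cross F m n)

theorem initChainMap_cross (F : Type u ⥤ Type u) (m n : ℕ) :
    initChainMap F m ≫ cross F (m + 1) n = cross F m n := by
  induction m generalizing n with
  | zero => ext x; exact x.elim
  | succ m ih =>
    cases n with
    | zero => rfl
    | succ n =>
      change F.map (initChainMap F m) ≫ F.map (cross F (m + 1) n) = F.map (cross F m n)
      rw [← F.map_comp, ih]

theorem cross_termChainMap (F : Type u ⥤ Type u) (m n : ℕ) :
    cross F m (n + 1) ≫ termChainMap F n = cross F m n := by
  induction m generalizing n with
  | zero => ext x; exact x.elim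
  | succ m ih =>
    cases n with
    | zero => rfl
    | succ n =>
      change F.map (cross F m (n + 1)) ≫ F.map (termChainMap F n) = F.map (cross F m n)
      rw [← F.map_comp, ih]

/-- The canonical map `Fᵐ0 ⟶ F^ω 1`, whose components are the canonical maps `Fᵐ0 ⟶ Fⁿ1`. -/
def stageToLimit (F : Type u ⥤ Type u) (m : ℕ) : initChain F m ⟶ OmegaLimit F :=
  ↾(fun z => ⟨fun n => cross F m n z,
    fun n => ConcreteCategory.congr_hom (cross_termChainMap F m n) z⟩)

theorem initChainMap_stageToLimit (F : Type u ⥤ Type u) (m : ℕ) :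
    initChainMap F m ≫ stageToLimit F (m + 1) = stageToLimit F m := by
  ext z
  exact Subtype.ext (funext fun n => ConcreteCategory.congr_hom (initChainMap_cross F m n) z)

/-- The canonical comparison map `ū : F^ω 0 ⟶ F^ω 1`. -/
def uBar (F : Type u ⥤ Type u) : OmegaColimit F ⟶ OmegaLimit F :=
  colimit.desc (Functor.ofSequence (initChainMap F))
    { pt := OmegaLimit F
      ι := NatTrans.ofSequence (F := Functor.ofSequence (initChainMap F))
        (G := (Functor.const ℕ).obj (OmegaLimit F)) (stageToLimit F) (fun n => by
          rw [Functor.ofSequence_map_homOfLE_succ]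
          exact (initChainMap_stageToLimit F n).trans (Category.comp_id _).symm) }

/-- `ū` is characterised by `v_{ω,n} ∘ ū ∘ w_{n,ω} = Fⁿ!` for all `n`, where `cross F n n = Fⁿ!`. -/
theorem initInj_uBar_termProj (F : Type u ⥤ Type u) (n : ℕ) :
    initInj F n ≫ uBar F ≫ termProj F n = cross F n n := by
  have h : initInj F n ≫ uBar F = stageToLimit F n := colimit.ι_desc _ _
  rw [← Category.assoc, h]
  rfl

/-- `Fⁿp : Fⁿ1 ⟶ Fⁿ⁺¹0` for an element `p` of `F∅`, regarded as a map `p : 1 ⟶ F∅`. -/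
def iterPoint (F : Type u ⥤ Type u) (p : F.obj PEmpty.{u + 1}) :
    ∀ n : ℕ, termChain F n ⟶ initChain F (n + 1)
  | 0 => ↾(fun _ => p)
  | n + 1 => F.map (iterPoint F p n)

/-- `e_n = ū ∘ w_{n+1,ω} ∘ Fⁿp : Fⁿ1 ⟶ F^ω 1`. -/
def eMap (F : Type u ⥤ Type u) (p : F.obj PEmpty.{u + 1}) (n : ℕ) :
    termChain F n ⟶ OmegaLimit F :=
  iterPoint F p n ≫ initInj F (n + 1) ≫ uBar F

/-- `ε_n = e_n ∘ v_{ω,n} : F^ω 1 ⟶ F^ω 1`. -/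
def epsilon (F : Type u ⥤ Type u) (p : F.obj PEmpty.{u + 1}) (n : ℕ) :
    OmegaLimit F ⟶ OmegaLimit F :=
  termProj F n ≫ eMap F p n

/-- The components `X ⟶ Fⁿ1` of the canonical cone of a coalgebra `(X, ξ)` over the
terminal-coalgebra chain: `h₀ = !` and `h_{n+1} = F h_n ∘ ξ`. -/
def coalgToStage {F : Type u ⥤ Type u} (X : Endofunctor.Coalgebra F) :
    ∀ n : ℕ, X.V ⟶ termChain F n
  | 0 => ↾(fun _ => PUnit.unit)
  | n + 1 => X.str ≫ F.map (coalgToStage X n)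

theorem coalgToStage_termChainMap {F : Type u ⥤ Type u} (X : Endofunctor.Coalgebra F) (n : ℕ) :
    coalgToStage X (n + 1) ≫ termChainMap F n = coalgToStage X n := by
  induction n with
  | zero => rfl
  | succ n ih =>
    change (X.str ≫ F.map (coalgToStage X (n + 1))) ≫ F.map (termChainMap F n) =
      X.str ≫ F.map (coalgToStage X n)
    rw [Category.assoc, ← F.map_comp, ih]

/-- The canonical map of a coalgebra into `F^ω 1`. For the terminal coalgebra of a finitary functor,
carried by `νF = F^{ω+ω} 1`, this is the connecting map `v_{ω+ω,ω}`. -/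
def coalgToLimit {F : Type u ⥤ Type u} (X : Endofunctor.Coalgebra F) : X.V ⟶ OmegaLimit F :=
  ↾(fun x => ⟨fun n => coalgToStage X n x,
    fun n => ConcreteCategory.congr_hom (coalgToStage_termChainMap X n) x⟩)

/-- The inverse `ι⁻¹` of the structure map of an initial algebra. -/
abbrev iotaInv {F : Type u ⥤ Type u} {M : Endofunctor.Algebra F} (hM : IsInitial M) :
    M.a ⟶ F.obj M.a :=
  Endofunctor.Algebra.Initial.strInv hM

/-- The unique coalgebra homomorphism `m : (μF, ι⁻¹) ⟶ (νF, τ)`. -/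
def muToNu {F : Type u ⥤ Type u} {M : Endofunctor.Algebra F} (hM : IsInitial M)
    {N : Endofunctor.Coalgebra F} (hN : IsTerminal N) : M.a ⟶ N.V :=
  (hN.from ⟨M.a, iotaInv hM⟩).f

end

/-- A cpo: a poset in which every (nonempty) directed subset has a join. -/
def IsCpo (P : Type u) [PartialOrder P] : Prop :=
  ∀ D : Set P, D.Nonempty → DirectedOn (· ≤ ·) D → ∃ x, IsLUB D x

/-- `i : P → K` exhibits `K` as a conservative completion of the poset `P`: `K` is a cpo, `i` embeds
`P` as a subposet and preserves all directed joins which exist in `P`, and every continuous map from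
`P` into a cpo has a unique continuous extension along `i`. -/
structure IsConservativeCompletion {P K : Type u} [PartialOrder P] [PartialOrder K]
    (i : P → K) : Prop where
  isCpo : IsCpo K
  le_iff_le : ∀ x y : P, i x ≤ i y ↔ x ≤ y
  continuous : ScottContinuous i
  existsUnique_extension : ∀ (Q : Type u) [PartialOrder Q], IsCpo Q →
    ∀ f : P → Q, ScottContinuous f → ∃! g : K → Q, ScottContinuous g ∧ ∀ x, g (i x) = f x

end SetFunctor

/-! The proof rests on the calculus of the maps `ε_n`. Since `Fⁿp` is a section of `Fⁿ⁺¹0 ⟶ Fⁿ1`,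
and composing `Fⁿ!` with it gives `w_{n,n+1}`, the point `ε_n(s)` has the same component `n` as `s`,
depends only on that component, and comes from a finite stage `Fⁿ⁺¹0`. Hence `ε_n ε_k = ε_{min n
k}`, and points of `F^ω 1` correspond to coherent sequences of truncations (`isTruncation_epsilon`).

The order theory uses only this structure: each point is the join of its truncations, truncations
are compact, and directed joins exist. So `F^ω 1` is a conservative completion of every subposet
containing all truncations (`IsTruncation.isConservativeCompletion`).

It remains to see that `μF` and `νF` are such subposets. Truncations come from stages `Fⁿ0`, hence
from `μF`. Injectivity of `h` follows from that of `F(F^ω 1) ⟶ F^ω 1`, where finitariness enters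
(`limitStr_injective`); injectivity of `h ∘ m` uses `p` (`coalgToLimit_muToNu_injective`). -/

namespace SetFunctor

/-! ### Posets with truncation operators and their conservative completions -/

section Truncation

variable {K : Type*} [PartialOrder K]

/-- A sequence of truncation operators `e n` on a poset: the elements below `s` are `s` and its
truncations, truncations compose by taking minima, and every coherent sequence of truncations comes
from exactly one element. -/
structure IsTruncation (e : ℕ → K → K) : Prop where
  le_iff : ∀ t s, t ≤ s ↔ t = s ∨ ∃ n, t = e n s
  comp : ∀ n k s, e n (e k s) = e (min n k) s
  ext : ∀ t s, (∀ n, e n t = e n s) → t = s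
  exists_of_coherent : ∀ x : ℕ → K, (∀ n, e n (x (n + 1)) = x n) → ∃ l, ∀ n, e n l = x n

namespace IsTruncation

variable {e : ℕ → K → K} (h : IsTruncation e)
include h

theorem apply_le (n : ℕ) (s : K) : e n s ≤ s := (h.le_iff _ _).2 (Or.inr ⟨n, rfl⟩)

theorem monotone_index (s : K) : Monotone fun n => e n s := fun n k hnk => by
  refine (h.le_iff _ _).2 (Or.inr ⟨n, ?_⟩)
  rw [h.comp, min_eq_left hnk]

theorem monotone_apply (n : ℕ) : Monotone (e n) := fun t s hts => by
  rcases (h.le_iff _ _).1 hts with rfl | ⟨k, rfl⟩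
  · exact le_rfl
  · rw [h.comp]
    exact h.monotone_index s (min_le_left _ _)

/-- If `e n t ≠ e n s`, then for `m ≥ n` the element `e m t ≤ s` can only be `e k s` with `k < n`.
Truncating at `n` gives `e m t = e n t`, so the truncations of `t` are constant from `n` on and `t =
e n t`. -/
theorem le_of_forall_apply_le {t s : K} (hts : ∀ n, e n t ≤ s) : t ≤ s := by
  by_cases hall : ∀ n, e n t = e n s
  · exact (h.ext _ _ hall).le
  push Not at hall
  obtain ⟨n, hn⟩ := hall
  have key : ∀ m, n ≤ m → e m t = e n t := fun m hm => by
    have hnm : e n (e m t) = e n t := by rw [h.comp, min_eq_left hm]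
    rcases (h.le_iff _ _).1 (hts m) with hs | ⟨k, hk⟩
    · exact absurd (by rw [← hs, hnm]) hn
    · rcases le_total n k with hnk | hkn
      · exact absurd (by rw [← hnm, hk, h.comp, min_eq_left hnk]) hn
      · rw [← hnm, hk, h.comp, min_eq_right hkn]
  have : t = e n t := h.ext _ _ fun m => by
    rw [h.comp]
    rcases le_total n m with hnm | hmn
    · rw [min_eq_right hnm, key m hnm]
    · rw [min_eq_left hmn]
  exact this ▸ hts n

theorem isLUB_range_apply (t : K) : IsLUB (Set.range fun n => e n t) t :=
  ⟨by rintro _ ⟨n, rfl⟩; exact h.apply_le n t,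
    fun _ hs => h.le_of_forall_apply_le fun n => hs ⟨n, rfl⟩⟩

omit h in
/-- A nonempty directed set all of whose elements lie in a finite set contains an upper bound of
itself. -/
theorem exists_mem_upperBounds_of_finite {D : Set K} (hne : D.Nonempty)
    (hD : DirectedOn (· ≤ ·) D) (hfin : D.Finite) : ∃ x ∈ D, x ∈ upperBounds D := by
  obtain ⟨x, hx⟩ := hfin.exists_maximal hne
  refine ⟨x, hx.prop, fun y hy => ?_⟩
  obtain ⟨z, hz, hxz, hyz⟩ := hD x hx.prop y hy
  exact hyz.trans (hx.le_of_ge hz hxz)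

/-- Truncations are compact elements. -/
theorem exists_apply_le_of_isLUB {D : Set K} (hne : D.Nonempty) (hD : DirectedOn (· ≤ ·) D)
    {a : K} (ha : IsLUB D a) (n : ℕ) : ∃ x ∈ D, e n a ≤ x := by
  by_contra! hcon
  -- Otherwise every member of `D` is some `e k a` with `k < n`, so `D` is finite and its greatest
  -- element is already above `a`.
  have hsub : D ⊆ (fun k => e k a) '' Set.Iio n := fun x hx => by
    rcases (h.le_iff _ _).1 (ha.1 hx) with rfl | ⟨k, rfl⟩
    · exact absurd (h.apply_le n x) (hcon x hx)
    · exact ⟨k, lt_of_not_ge fun hnk => hcon _ hx (h.monotone_index a hnk), rfl⟩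
  obtain ⟨x, hx, hub⟩ :=
    exists_mem_upperBounds_of_finite hne hD (((Set.finite_Iio n).image _).subset hsub)
  exact hcon x hx ((h.apply_le n a).trans (ha.2 hub))

theorem exists_apply_eq_of_lt {x y : K} (hxy : x < y) : ∃ n, x = e n y ∧ e n x = x := by
  rcases (h.le_iff _ _).1 hxy.le with rfl | ⟨n, rfl⟩
  · exact absurd hxy (lt_irrefl _)
  · exact ⟨n, rfl, by rw [h.comp, min_self]⟩

/-- If `D` has no greatest element, each member is a truncation, and for each `n` the `n`-th
truncations are eventually constant along `D`. The eventual values are coherent, and the element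
they determine is the join. -/
theorem exists_isLUB {D : Set K} (hne : D.Nonempty) (hD : DirectedOn (· ≤ ·) D) :
    ∃ x, IsLUB D x := by
  by_cases hmax : ∃ x ∈ D, x ∈ upperBounds D
  · obtain ⟨x, hx, hub⟩ := hmax
    exact ⟨x, hub, fun _ hu => hu hx⟩
  have hlt : ∀ x ∈ D, ∃ y ∈ D, x < y := fun x hx => by
    have : ∃ z ∈ D, ¬ z ≤ x := by
      by_contra! hcon
      exact hmax ⟨x, hx, hcon⟩
    obtain ⟨z, hz, hzx⟩ := this
    obtain ⟨y, hy, hxy, hzy⟩ := hD x hx z hz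
    exact ⟨y, hy, lt_of_le_of_ne hxy fun hne => hzx (hne ▸ hzy)⟩
  have hfix : ∀ x ∈ D, ∃ n, e n x = x := fun x hx => by
    obtain ⟨y, -, hxy⟩ := hlt x hx
    obtain ⟨n, -, hn⟩ := h.exists_apply_eq_of_lt hxy
    exact ⟨n, hn⟩
  -- above every level there are elements of `D` whose truncation is stable in `D`
  have hstable : ∀ n, ∃ x ∈ D, ∀ y ∈ D, x ≤ y → e n y = e n x := fun n => by
    induction n with
    | zero =>
      obtain ⟨x, hx⟩ := hne
      refine ⟨x, hx, fun y _ hxy => ?_⟩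
      rcases (h.le_iff _ _).1 hxy with rfl | ⟨k, rfl⟩
      · rfl
      · rw [h.comp, Nat.zero_min]
    | succ n ih =>
      obtain ⟨x, hx, hst⟩ := ih
      -- Going strictly above `x` forces stability one level higher: if `x' = e k y` with `k ≤ n`,
      -- then `x' = e n x' = e n x ≤ x`, a contradiction; so `k ≥ n + 1`.
      obtain ⟨x', hx', hxx'⟩ := hlt x hx
      refine ⟨x', hx', fun y hy hxy => ?_⟩
      rcases (h.le_iff _ _).1 hxy with rfl | ⟨k, rfl⟩
      · rfl
      rcases Nat.lt_or_ge n k with hnk | hkn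
      · rw [h.comp, min_eq_left hnk]
      · exfalso
        have h1 : e n (e k y) = e k y := by rw [h.comp, min_eq_right hkn]
        have h2 : e k y = e n x := by rw [← h1, hst _ hx' hxx'.le]
        exact absurd (h.apply_le n x) (h2 ▸ not_le_of_gt hxx')
  choose x hxD hx using hstable
  have hcommon : ∀ n, ∀ y ∈ D, ∃ z ∈ D, y ≤ z ∧ e n z = e n (x n) := fun n y hy => by
    obtain ⟨z, hz, h1, h2⟩ := hD y hy _ (hxD n)
    exact ⟨z, hz, h1, hx n z hz h2⟩
  obtain ⟨l, hl⟩ := h.exists_of_coherent (fun n => e n (x n)) fun n => by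
    obtain ⟨z, hz, h1, h2⟩ := hcommon n _ (hxD (n + 1))
    have h3 := hx (n + 1) z hz h1
    change e n (e (n + 1) (x (n + 1))) = e n (x n)
    rw [← h3, h.comp, min_eq_left n.le_succ, h2]
  refine ⟨l, fun y hy => ?_, fun u hu => ?_⟩
  · obtain ⟨n, hn⟩ := hfix y hy
    obtain ⟨z, -, h1, h2⟩ := hcommon n y hy
    rw [← hn]
    exact ((h.monotone_apply n h1).trans (h2.trans (hl n).symm).le).trans (h.apply_le n l)
  · refine h.le_of_forall_apply_le fun n => ?_
    rw [hl n]
    exact (h.apply_le n _).trans (hu (hxD n))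

end IsTruncation

end Truncation

/-- The extension of `f` sends `s` to the join of the values of `f` at the truncations of `s`. It is
continuous because truncations are compact, and it is forced because `s` is the join of its
truncations. -/
theorem IsTruncation.isConservativeCompletion {P K : Type u} [PartialOrder P] [PartialOrder K]
    {e : ℕ → K → K} (h : IsTruncation e) {i : P → K} (hi : ∀ x y, i x ≤ i y ↔ x ≤ y)
    (hr : ∀ n s, ∃ x, i x = e n s) : IsConservativeCompletion i := by
  have hcont : ScottContinuous i := fun D hne hD a ha => by
    have hD' : DirectedOn (· ≤ ·) (i '' D) := by
      rintro _ ⟨x, hx, rfl⟩ _ ⟨y, hy, rfl⟩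
      obtain ⟨z, hz, h1, h2⟩ := hD x hx y hy
      exact ⟨i z, ⟨z, hz, rfl⟩, (hi _ _).2 h1, (hi _ _).2 h2⟩
    have hub : i a ∈ upperBounds (i '' D) := by
      rintro _ ⟨x, hx, rfl⟩
      exact (hi _ _).2 (ha.1 hx)
    obtain ⟨l, hl⟩ := h.exists_isLUB (hne.image i) hD'
    suffices l = i a from this ▸ hl
    -- If the join `l` formed in `K` differs from `i a`, it is a truncation of `i a`, hence lies in
    -- `P` and bounds `D` there; so `i a ≤ l` after all.
    rcases (h.le_iff _ _).1 (hl.2 hub) with hla | ⟨n, hn⟩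
    · exact hla
    · obtain ⟨b, hb⟩ := hr n (i a)
      refine le_antisymm (hl.2 hub) ?_
      rw [hn, ← hb]
      refine (hi _ _).2 (ha.2 fun x hx => (hi _ _).1 ?_)
      rw [hb, ← hn]
      exact hl.1 ⟨x, hx, rfl⟩
  refine ⟨fun D hne hD => h.exists_isLUB hne hD, hi, hcont, fun Q _ hQ f hf => ?_⟩
  choose r hr using hr
  have hrmono : ∀ s, Monotone fun n => r n s := fun s n k hnk => by
    rw [← hi, hr, hr]
    exact h.monotone_index s hnk
  have hfr : ∀ s, ∃ q, IsLUB (Set.range fun n => f (r n s)) q := fun s =>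
    hQ _ (Set.range_nonempty _)
      (directedOn_range.2 (directed_of_isDirected_le (hf.monotone.comp (hrmono s))))
  choose g hg using hfr
  have hgi : ∀ x, g (i x) = f x := fun x => by
    have hlub : IsLUB (Set.range fun n => r n (i x)) x := by
      refine ⟨?_, fun u hu => ?_⟩
      · rintro _ ⟨n, rfl⟩
        rw [← hi, hr]
        exact h.apply_le n _
      · rw [← hi]
        refine h.le_of_forall_apply_le fun n => ?_
        rw [← hr, hi]
        exact hu ⟨n, rfl⟩
    have := hf (Set.range_nonempty _)
      (directedOn_range.2 (directed_of_isDirected_le (hrmono (i x)))) hlub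
    rw [← Set.range_comp] at this
    exact (hg (i x)).unique this
  have hgmono : Monotone g := fun t s hts => by
    refine (hg t).2 ?_
    rintro _ ⟨n, rfl⟩
    refine (hf.monotone ?_).trans ((hg s).1 ⟨n, rfl⟩)
    rw [← hi, hr, hr]
    exact h.monotone_apply n hts
  refine ⟨g, ⟨fun D hne hD a ha => ⟨?_, fun u hu => (hg a).2 ?_⟩, hgi⟩, ?_⟩
  · rintro _ ⟨x, hx, rfl⟩
    exact hgmono (ha.1 hx)
  · rintro _ ⟨n, rfl⟩
    obtain ⟨x, hx, hle⟩ := h.exists_apply_le_of_isLUB hne hD ha n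
    change f (r n a) ≤ u
    rw [← hgi, hr]
    exact (hgmono hle).trans (hu ⟨x, hx, rfl⟩)
  · rintro g' ⟨hg', hgi'⟩
    funext s
    have := hg' (Set.range_nonempty _)
      (directedOn_range.2 (directed_of_isDirected_le (h.monotone_index s))) (h.isLUB_range_apply s)
    rw [← Set.range_comp] at this
    refine this.unique ?_
    have heq : (g' ∘ fun n => e n s) = fun n => f (r n s) := funext fun n => by
      change g' (e n s) = _
      rw [← hr, hgi']
    rw [heq]
    exact hg s

/-! ### The two chains and the truncations `ε_n` -/

section Chains

variable (F : Type u ⥤ Type u) (p : F.obj PEmpty.{u + 1})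

/-- This is `F` iterated on an identity of maps `1 ⟶ 1`. It makes `ε_n` preserve component `n`. -/
theorem iterPoint_cross (n : ℕ) :
    iterPoint F p n ≫ cross F (n + 1) n = 𝟙 (termChain F n) := by
  induction n with
  | zero => rfl
  | succ n ih =>
    change F.map (iterPoint F p n) ≫ F.map (cross F (n + 1) n) = 𝟙 (F.obj (termChain F n))
    rw [← F.map_comp, ih, F.map_id]

/-- This is `F` iterated on an identity of maps out of `∅`. It makes `ε_n` fix the image of `Fⁿ0`.
-/
theorem cross_iterPoint (n : ℕ) : cross F n n ≫ iterPoint F p n = initChainMap F n := by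
  induction n with
  | zero => ext x; exact x.elim
  | succ n ih =>
    change F.map (cross F n n) ≫ F.map (iterPoint F p n) = F.map (initChainMap F n)
    rw [← F.map_comp, ih]

theorem initInj_uBar (n : ℕ) : initInj F n ≫ uBar F = stageToLimit F n :=
  colimit.ι_desc _ _

theorem eMap_apply (n : ℕ) (x : termChain F n) :
    eMap F p n x = stageToLimit F (n + 1) (iterPoint F p n x) :=
  ConcreteCategory.congr_hom (initInj_uBar F (n + 1)) (iterPoint F p n x)

theorem epsilon_apply (n : ℕ) (x : OmegaLimit F) : epsilon F p n x = eMap F p n (x.1 n) := rfl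

theorem eMap_apply_val (n : ℕ) (x : termChain F n) : (eMap F p n x).1 n = x := by
  rw [eMap_apply]
  exact ConcreteCategory.congr_hom (iterPoint_cross F p n) x

variable {F} in
theorem OmegaLimit.val_eq_of_le {x y : OmegaLimit F} {n k : ℕ} (hnk : n ≤ k)
    (hxy : x.1 k = y.1 k) : x.1 n = y.1 n := by
  induction k, hnk using Nat.le_induction with
  | base => exact hxy
  | succ k _ ih => exact ih (by rw [← x.2 k, ← y.2 k, hxy])

theorem epsilon_apply_val {n k : ℕ} (hnk : n ≤ k) (x : OmegaLimit F) :
    (epsilon F p k x).1 n = x.1 n :=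
  OmegaLimit.val_eq_of_le hnk (eMap_apply_val F p k _)

theorem exists_stageToLimit_eq {m n : ℕ} (hmn : m ≤ n) (z : initChain F m) :
    ∃ z' : initChain F n, stageToLimit F n z' = stageToLimit F m z := by
  induction n, hmn using Nat.le_induction with
  | base => exact ⟨z, rfl⟩
  | succ n _ ih =>
    obtain ⟨z', hz'⟩ := ih
    exact ⟨initChainMap F n z',
      (ConcreteCategory.congr_hom (initChainMap_stageToLimit F n) z').trans hz'⟩

theorem epsilon_stageToLimit {m n : ℕ} (hmn : m ≤ n) (z : initChain F m) :
    epsilon F p n (stageToLimit F m z) = stageToLimit F m z := by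
  obtain ⟨z', hz'⟩ := exists_stageToLimit_eq F hmn z
  rw [← hz', epsilon_apply, eMap_apply]
  have h1 : iterPoint F p n ((stageToLimit F n z').1 n) = initChainMap F n z' :=
    ConcreteCategory.congr_hom (cross_iterPoint F p n) z'
  rw [h1]
  exact ConcreteCategory.congr_hom (initChainMap_stageToLimit F n) z'

/-- For `k < n`, `ε_k(x)` comes from stage `k + 1 ≤ n`, which `ε_n` fixes. For `n ≤ k`, `ε_n` reads
only component `n`, which `ε_k` leaves unchanged. -/
theorem epsilon_epsilon (n k : ℕ) (x : OmegaLimit F) :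
    epsilon F p n (epsilon F p k x) = epsilon F p (min n k) x := by
  rcases Nat.lt_or_ge k n with hkn | hnk
  · rw [min_eq_right hkn.le, epsilon_apply F p k, eMap_apply, epsilon_stageToLimit F p hkn]
  · rw [min_eq_left hnk, epsilon_apply F p n, epsilon_apply_val F p hnk, epsilon_apply F p n]

/-- The order on `F^ω 1`: `t ≤ s` iff `t = s` or `t = ε_n(s)` for some `n`. -/
@[reducible]
def omegaLimitOrder : PartialOrder (OmegaLimit F) where
  le t s := t = s ∨ ∃ n, t = epsilon F p n s
  le_refl t := Or.inl rfl
  le_trans t s r := by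
    rintro (rfl | ⟨n, rfl⟩) hsr
    · exact hsr
    · rcases hsr with rfl | ⟨k, rfl⟩
      · exact Or.inr ⟨n, rfl⟩
      · exact Or.inr ⟨min n k, epsilon_epsilon F p n k r⟩
  le_antisymm t s := by
    rintro (rfl | ⟨n, hn⟩) hst
    · rfl
    · rcases hst with rfl | ⟨k, hk⟩
      · rfl
      · rcases le_total n k with hnk | hkn
        · rw [hk, hn, epsilon_epsilon, min_eq_right hnk]
        · exact hn.trans (by rw [hk, epsilon_epsilon, min_eq_right hkn])

theorem isTruncation_epsilon :
    let := omegaLimitOrder F p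
    IsTruncation fun n x => epsilon F p n x := by
  let := omegaLimitOrder F p
  -- A coherent sequence of truncations is realised by its diagonal of components.
  refine ⟨fun t s => Iff.rfl, epsilon_epsilon F p, fun t s hts => Subtype.ext (funext fun n => ?_),
    fun x hx => ⟨⟨fun n => (x n).1 n, fun n => ?_⟩, fun n => ?_⟩⟩
  · rw [← epsilon_apply_val F p le_rfl t, ← epsilon_apply_val F p le_rfl s]
    exact congrArg (fun y : OmegaLimit F => y.1 n) (hts n)
  · refine ((x (n + 1)).2 n).trans ?_
    change _ = (x n).1 n
    rw [← hx n]
    exact (epsilon_apply_val F p le_rfl _).symm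
  · change eMap F p n ((x n).1 n) = x n
    rw [← epsilon_apply, ← hx n]
    exact (epsilon_epsilon F p n n _).trans (by rw [min_self])

end Chains

end SetFunctor

namespace SetFunctor

/-! ### Finitary functors and finite subsets -/

section Finitary

/-- An injection with nonempty domain is a split monomorphism, and these are preserved by every
functor. -/
theorem map_injective_of_nonempty (F : Type u ⥤ Type u) {X Y : Type u} [Nonempty X] (f : X ⟶ Y)
    (hf : Function.Injective f) : Function.Injective (F.map f) := by
  have hsec : f ≫ (↾(Function.invFun f)) = 𝟙 X := by
    ext x
    exact Function.leftInverse_invFun hf x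
  intro a b hab
  have h : F.map f ≫ F.map (↾(Function.invFun f)) = 𝟙 (F.obj X) := by
    rw [← F.map_comp, hsec, F.map_id]
  exact (ConcreteCategory.congr_hom h a).symm.trans
    ((congrArg (F.map (↾(Function.invFun f))) hab).trans (ConcreteCategory.congr_hom h b))

/-- The diagram of the finite subsets of a set. -/
def finsetDiagram (X : Type u) : Finset X ⥤ Type u where
  obj S := {x : X // x ∈ S}
  map f := ↾(fun x => ⟨x.1, leOfHom f x.2⟩)

/-- The cocone which exhibits a set as the union of its finite subsets. -/
def finsetCocone (X : Type u) : Cocone (finsetDiagram X) where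
  pt := X
  ι := { app := fun S => ↾(fun x : {x : X // x ∈ S} => x.1) }

/-- Every set is the filtered colimit of its finite subsets. -/
noncomputable def isColimitFinsetCocone (X : Type u) : IsColimit (finsetCocone X) := by
  classical
  refine Types.FilteredColimit.isColimitOf' _ (finsetCocone X)
    (fun x : X => ⟨({x} : Finset X), Subtype.mk x (Finset.mem_singleton_self x), rfl⟩)
    (fun S x y hxy => ⟨S, 𝟙 S, congrArg ((finsetDiagram X).map (𝟙 S)) ?_⟩)
  exact Subtype.ext hxy

variable (F : Type u ⥤ Type u) [PreservesFilteredColimits F]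

/-- Every element of `F X`, for `F` finitary, comes from a finite subset of `X`. -/
theorem exists_finset_map_eq {X : Type u} (a : F.obj X) :
    ∃ (S : Finset X) (b : F.obj {x : X // x ∈ S}), F.map (↾(fun x => x.1)) b = a := by
  classical
  exact Types.jointly_surjective _ (isColimitOfPreserves F (isColimitFinsetCocone X)) a

/-- The extra point inserted into the finite set makes it nonempty, so that
`map_injective_of_nonempty` applies to maps out of it. -/
theorem exists_nonempty_finset_map_eq₂ {X : Type u} [Nonempty X] (a a' : F.obj X) :
    ∃ (S : Finset X) (b b' : F.obj {x : X // x ∈ S}), S.Nonempty ∧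
      F.map (↾(fun x => x.1)) b = a ∧ F.map (↾(fun x => x.1)) b' = a' := by
  classical
  obtain ⟨S, b, rfl⟩ := exists_finset_map_eq F a
  obtain ⟨S', b', rfl⟩ := exists_finset_map_eq F a'
  obtain ⟨x⟩ := ‹Nonempty X›
  refine ⟨insert x (S ∪ S'),
    F.map (↾(fun y => ⟨y.1, Finset.mem_insert_of_mem (Finset.mem_union_left _ y.2)⟩)) b,
    F.map (↾(fun y => ⟨y.1, Finset.mem_insert_of_mem (Finset.mem_union_right _ y.2)⟩)) b',
    Finset.insert_nonempty _ _, ?_, ?_⟩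
  all_goals
    rw [← ConcreteCategory.comp_apply, ← F.map_comp]
    rfl

end Finitary

/-! ### The algebra structure of `F^ω 1` -/

section LimitAlgebra

variable (F : Type u ⥤ Type u)

/-- The components `F(F^ω 1) ⟶ Fⁿ1` of the algebra structure of `F^ω 1`. -/
def limitStrStage : ∀ n, F.obj (OmegaLimit F) ⟶ termChain F n
  | 0 => ↾(fun _ => PUnit.unit)
  | n + 1 => F.map (termProj F n)

theorem termProj_termChainMap (n : ℕ) :
    termProj F (n + 1) ≫ termChainMap F n = termProj F n := by
  ext x
  exact x.2 n

theorem limitStrStage_termChainMap (n : ℕ) :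
    limitStrStage F (n + 1) ≫ termChainMap F n = limitStrStage F n := by
  cases n with
  | zero => rfl
  | succ n =>
    change F.map (termProj F (n + 1)) ≫ F.map (termChainMap F n) = F.map (termProj F n)
    rw [← F.map_comp, termProj_termChainMap]

/-- The canonical map `F(F^ω 1) ⟶ F^ω 1`. -/
def limitStr : F.obj (OmegaLimit F) ⟶ OmegaLimit F :=
  ↾(fun a => ⟨fun n => limitStrStage F n a,
    fun n => ConcreteCategory.congr_hom (limitStrStage_termChainMap F n) a⟩)

variable {F} in
theorem OmegaLimit.hom_ext {X : Type u} {f g : X ⟶ OmegaLimit F}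
    (h : ∀ n, f ≫ termProj F n = g ≫ termProj F n) : f = g := by
  ext x
  exact Subtype.ext (funext fun n => ConcreteCategory.congr_hom (h n) x)

/-- Both elements come from a finite set `S` of points, on which some projection `v_{ω,n}` is
injective. Then `F S ⟶ Fⁿ⁺¹1` is injective, and it factors through `limitStr F`. -/
theorem limitStr_injective [PreservesFilteredColimits F] [Nonempty (OmegaLimit F)] :
    Function.Injective (limitStr F) := by
  intro a a' haa'
  obtain ⟨S, b, b', ⟨s, hs⟩, rfl, rfl⟩ := exists_nonempty_finset_map_eq₂ F a a'
  -- finitely many elements of the limit are separated by one of its projections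
  have hsep : ∃ n, ∀ x ∈ S, ∀ y ∈ S, x.1 n = y.1 n → x = y := by
    have hpair : ∀ x y : OmegaLimit F, ∃ n, x.1 n = y.1 n → x = y := fun x y => by
      by_contra! hcon
      exact (hcon 0).2 (Subtype.ext (funext fun n => (hcon n).1))
    choose k hk using hpair
    refine ⟨S.sup fun x => S.sup fun y => k x y, fun x hx y hy hxy => hk x y ?_⟩
    refine OmegaLimit.val_eq_of_le ?_ hxy
    exact (Finset.le_sup (f := fun y => k x y) hy).trans
      (Finset.le_sup (f := fun x => S.sup fun y => k x y) hx)
  obtain ⟨n, hn⟩ := hsep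
  have : Nonempty {x : OmegaLimit F // x ∈ S} := ⟨⟨s, hs⟩⟩
  have hinj := map_injective_of_nonempty F
    ((↾(fun x : {x : OmegaLimit F // x ∈ S} => x.1)) ≫ termProj F n)
    (fun x y hxy => Subtype.ext (hn x.1 x.2 y.1 y.2 hxy))
  refine congrArg _ (hinj ?_)
  rw [F.map_comp]
  exact congrArg (fun y : OmegaLimit F => y.1 (n + 1)) haa'

variable {F}

/-- The canonical map of a coalgebra into `F^ω 1` is a coalgebra-to-algebra homomorphism. -/
theorem coalgToLimit_eq (X : Endofunctor.Coalgebra F) :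
    coalgToLimit X = X.str ≫ F.map (coalgToLimit X) ≫ limitStr F := by
  refine OmegaLimit.hom_ext fun n => ?_
  cases n with
  | zero => rfl
  | succ n =>
    change X.str ≫ F.map (coalgToLimit X ≫ termProj F n) =
      X.str ≫ F.map (coalgToLimit X) ≫ F.map (termProj F n)
    rw [F.map_comp]

theorem hom_coalgToStage {X Y : Endofunctor.Coalgebra F} (f : X ⟶ Y) (n : ℕ) :
    f.f ≫ coalgToStage Y n = coalgToStage X n := by
  induction n with
  | zero => rfl
  | succ n ih =>
    change f.f ≫ Y.str ≫ F.map (coalgToStage Y n) = X.str ≫ F.map (coalgToStage X n)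
    rw [← ih, F.map_comp, ← Category.assoc, ← Category.assoc, f.h]

theorem hom_coalgToLimit {X Y : Endofunctor.Coalgebra F} (f : X ⟶ Y) :
    f.f ≫ coalgToLimit Y = coalgToLimit X :=
  OmegaLimit.hom_ext fun n => hom_coalgToStage f n

theorem stageToLimit_succ (n : ℕ) :
    stageToLimit F (n + 1) = F.map (stageToLimit F n) ≫ limitStr F := by
  refine OmegaLimit.hom_ext fun k => ?_
  cases k with
  | zero => rfl
  | succ k =>
    change F.map (stageToLimit F n ≫ termProj F k) =
      F.map (stageToLimit F n) ≫ F.map (termProj F k)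
    rw [F.map_comp]

end LimitAlgebra

/-! ### The terminal coalgebra as a subset of `F^ω 1` -/

section TerminalCoalgebra

variable (F : Type u ⥤ Type u)

/-- The elements of `F^ω 1` which are the behaviour of an element of some coalgebra. -/
def Behaviour : Type u :=
  {t : OmegaLimit F // ∃ (X : Endofunctor.Coalgebra F) (x : X.V), coalgToLimit X x = t}

/-- The inclusion of the behaviours into `F^ω 1`. -/
def behaviourIncl : Behaviour F ⟶ OmegaLimit F := ↾(fun t => t.1)

variable {F}

/-- The map of a coalgebra to the behaviours of its elements. -/
def toBehaviour (X : Endofunctor.Coalgebra F) : X.V ⟶ Behaviour F :=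
  ↾(fun x => ⟨coalgToLimit X x, X, x, rfl⟩)

theorem toBehaviour_incl (X : Endofunctor.Coalgebra F) :
    toBehaviour X ≫ behaviourIncl F = coalgToLimit X := rfl

variable (F) in
theorem behaviourIncl_injective : Function.Injective (behaviourIncl F) :=
  fun _ _ h => Subtype.ext h

variable [PreservesFilteredColimits F]

/-- This makes the structure on behaviours independent of the chosen representative. The injective
map `limitStr F ∘ F(behaviourIncl F)` sends the two sides to the behaviours of `x` and `y`. -/
theorem toBehaviour_str_congr {X Y : Endofunctor.Coalgebra F} (x : X.V) (y : Y.V)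
    (h : coalgToLimit X x = coalgToLimit Y y) :
    F.map (toBehaviour X) (X.str x) = F.map (toBehaviour Y) (Y.str y) := by
  have : Nonempty (OmegaLimit F) := ⟨coalgToLimit X x⟩
  have : Nonempty (Behaviour F) := ⟨toBehaviour X x⟩
  apply map_injective_of_nonempty F _ (behaviourIncl_injective F)
  apply limitStr_injective F
  have key : ∀ (Z : Endofunctor.Coalgebra F) (z : Z.V),
      limitStr F (F.map (behaviourIncl F) (F.map (toBehaviour Z) (Z.str z))) =
        coalgToLimit Z z := fun Z z => by
    have h1 := ConcreteCategory.congr_hom (coalgToLimit_eq Z) z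
    rw [← toBehaviour_incl, F.map_comp] at h1
    exact h1.symm
  rw [key, key, h]

variable (F) in
/-- The coalgebra of behaviours. -/
noncomputable def behaviourCoalgebra : Endofunctor.Coalgebra F where
  V := Behaviour F
  str := ↾(fun t => F.map (toBehaviour t.2.choose) (t.2.choose.str t.2.choose_spec.choose))

theorem toBehaviour_str (X : Endofunctor.Coalgebra F) :
    X.str ≫ F.map (toBehaviour X) = toBehaviour X ≫ (behaviourCoalgebra F).str := by
  ext x
  exact toBehaviour_str_congr x _ (toBehaviour X x).2.choose_spec.choose_spec.symm

/-- The behaviour map as a coalgebra homomorphism. -/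
noncomputable def toBehaviourHom (X : Endofunctor.Coalgebra F) : X ⟶ behaviourCoalgebra F where
  f := toBehaviour X
  h := toBehaviour_str X

variable (F) in
theorem coalgToLimit_behaviourCoalgebra :
    coalgToLimit (behaviourCoalgebra F) = behaviourIncl F := by
  ext t
  obtain ⟨_, X, x, rfl⟩ := t
  exact ConcreteCategory.congr_hom (hom_coalgToLimit (toBehaviourHom X)) x

variable (F) in
/-- The coalgebra of behaviours is terminal. -/
noncomputable def isTerminalBehaviourCoalgebra : IsTerminal (behaviourCoalgebra F) :=
  IsTerminal.ofUniqueHom toBehaviourHom fun X g => by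
    refine Endofunctor.Coalgebra.ext ?_
    ext x
    -- Homomorphisms preserve behaviour, and each element of the coalgebra of behaviours is its own
    -- behaviour.
    apply behaviourIncl_injective F
    have h := ConcreteCategory.congr_hom (hom_coalgToLimit g) x
    rw [coalgToLimit_behaviourCoalgebra] at h
    exact h

theorem coalgToLimit_injective {N : Endofunctor.Coalgebra F} (hN : IsTerminal N) :
    Function.Injective (coalgToLimit N) := by
  let θ := hN.uniqueUpToIso (isTerminalBehaviourCoalgebra F)
  have hθ : θ.hom.f ≫ θ.inv.f = 𝟙 N.V := congrArg Endofunctor.Coalgebra.Hom.f θ.hom_inv_id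
  intro x y hxy
  have h : θ.hom.f x = θ.hom.f y := by
    apply behaviourIncl_injective F
    rw [← hom_coalgToLimit θ.hom, coalgToLimit_behaviourCoalgebra] at hxy
    exact hxy
  exact (ConcreteCategory.congr_hom hθ x).symm.trans
    ((congrArg θ.inv.f h).trans (ConcreteCategory.congr_hom hθ y))

end TerminalCoalgebra

end SetFunctor

namespace SetFunctor

/-! ### The initial algebra as the colimit `F^ω 0` -/

section InitialAlgebra

variable {F : Type u ⥤ Type u}

/-- The canonical maps `Fⁿ0 ⟶ B` to the carrier of an algebra `B`. -/
def stageToAlg (B : Endofunctor.Algebra F) : ∀ n : ℕ, initChain F n ⟶ B.a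
  | 0 => ↾(fun x : PEmpty.{u + 1} => x.elim)
  | n + 1 => F.map (stageToAlg B n) ≫ B.str

theorem initChainMap_stageToAlg (B : Endofunctor.Algebra F) (n : ℕ) :
    initChainMap F n ≫ stageToAlg B (n + 1) = stageToAlg B n := by
  induction n with
  | zero => ext x; exact x.elim
  | succ n ih =>
    change F.map (initChainMap F n) ≫ F.map (stageToAlg B (n + 1)) ≫ B.str =
      F.map (stageToAlg B n) ≫ B.str
    rw [← Category.assoc, ← F.map_comp, ih]

theorem stageToAlg_hom {B B' : Endofunctor.Algebra F} (f : B ⟶ B') (n : ℕ) :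
    stageToAlg B n ≫ f.f = stageToAlg B' n := by
  induction n with
  | zero => ext x; exact x.elim
  | succ n ih =>
    change (F.map (stageToAlg B n) ≫ B.str) ≫ f.f = F.map (stageToAlg B' n) ≫ B'.str
    rw [← ih, F.map_comp, Category.assoc, Category.assoc, f.h]

variable (F)

theorem initChainMap_initInj (n : ℕ) : initChainMap F n ≫ initInj F (n + 1) = initInj F n := by
  have h := colimit.w (Functor.ofSequence (initChainMap F)) (homOfLE (Nat.le_add_right n 1))
  rw [Functor.ofSequence_map_homOfLE_succ] at h
  exact h

variable {F} in
theorem OmegaColimit.hom_ext {X : Type u} {f g : OmegaColimit F ⟶ X}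
    (h : ∀ n, initInj F n ≫ f = initInj F n ≫ g) : f = g :=
  colimit.hom_ext h

variable {F} in
/-- The map out of `F^ω 0` induced by compatible maps out of the stages `Fⁿ0`. -/
noncomputable def OmegaColimit.desc {X : Type u} (f : ∀ n, initChain F n ⟶ X)
    (hf : ∀ n, initChainMap F n ≫ f (n + 1) = f n) : OmegaColimit F ⟶ X :=
  colimit.desc (Functor.ofSequence (initChainMap F))
    { pt := X
      ι := NatTrans.ofSequence (F := Functor.ofSequence (initChainMap F))
        (G := (Functor.const ℕ).obj X) f (fun n => by
          rw [Functor.ofSequence_map_homOfLE_succ]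
          exact (hf n).trans (Category.comp_id _).symm) }

variable {F} in
theorem OmegaColimit.initInj_desc {X : Type u} (f : ∀ n, initChain F n ⟶ X)
    (hf : ∀ n, initChainMap F n ≫ f (n + 1) = f n) (n : ℕ) :
    initInj F n ≫ OmegaColimit.desc f hf = f n :=
  colimit.ι_desc _ _

variable [PreservesFilteredColimits F]

/-- A finitary functor preserves the colimit `F^ω 0`. -/
noncomputable def isColimitMapOmega :
    IsColimit (F.mapCocone (colimit.cocone (Functor.ofSequence (initChainMap F)))) :=
  -- The index category `ℕ` lives in universe `0`, whereas the hypothesis on `F` concerns diagrams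
  -- of size `u`.
  have : PreservesFilteredColimitsOfSize.{0, 0} F :=
    preservesFilteredColimitsOfSize_shrink.{0, u, 0, u} F
  have := PreservesFilteredColimitsOfSize.preserves_filtered_colimits (F := F) ℕ
  isColimitOfPreserves F (colimit.isColimit _)

variable {F} in
theorem map_omegaColimit_hom_ext {X : Type u} {f g : F.obj (OmegaColimit F) ⟶ X}
    (h : ∀ n, F.map (initInj F n) ≫ f = F.map (initInj F n) ≫ g) : f = g :=
  (isColimitMapOmega F).hom_ext h

/-- The structure map `F(F^ω 0) ⟶ F^ω 0`. -/
noncomputable def omegaStr : F.obj (OmegaColimit F) ⟶ OmegaColimit F :=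
  (isColimitMapOmega F).desc
    { pt := OmegaColimit F
      ι := NatTrans.ofSequence (F := Functor.ofSequence (initChainMap F) ⋙ F)
        (G := (Functor.const ℕ).obj (OmegaColimit F)) (fun n => initInj F (n + 1)) (fun n => by
          rw [Functor.comp_map, Functor.ofSequence_map_homOfLE_succ]
          exact (initChainMap_initInj F (n + 1)).trans (Category.comp_id _).symm) }

theorem map_initInj_omegaStr (n : ℕ) : F.map (initInj F n) ≫ omegaStr F = initInj F (n + 1) :=
  (isColimitMapOmega F).fac _ n

/-- The algebra `F^ω 0`. -/
noncomputable def omegaAlgebra : Endofunctor.Algebra F := ⟨OmegaColimit F, omegaStr F⟩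

variable {F} in
/-- The canonical homomorphism from `F^ω 0` to an algebra. -/
noncomputable def omegaDesc (B : Endofunctor.Algebra F) : omegaAlgebra F ⟶ B where
  f := OmegaColimit.desc (stageToAlg B) (initChainMap_stageToAlg B)
  h := map_omegaColimit_hom_ext fun n => by
    change F.map (initInj F n) ≫ F.map (OmegaColimit.desc _ _) ≫ B.str =
      F.map (initInj F n) ≫ omegaStr F ≫ OmegaColimit.desc _ _
    rw [← Category.assoc, ← F.map_comp, OmegaColimit.initInj_desc, ← Category.assoc,
      map_initInj_omegaStr]
    exact (OmegaColimit.initInj_desc (stageToAlg B) (initChainMap_stageToAlg B) (n + 1)).symm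

theorem stageToAlg_omegaAlgebra (n : ℕ) : stageToAlg (omegaAlgebra F) n = initInj F n := by
  induction n with
  | zero => ext x; exact x.elim
  | succ n ih =>
    change F.map (stageToAlg (omegaAlgebra F) n) ≫ omegaStr F = _
    rw [ih]
    exact map_initInj_omegaStr F n

/-- `F^ω 0` is an initial algebra of a finitary functor `F`. -/
noncomputable def isInitialOmegaAlgebra : IsInitial (omegaAlgebra F) :=
  IsInitial.ofUniqueHom omegaDesc fun B g => by
    refine Endofunctor.Algebra.ext (OmegaColimit.hom_ext fun n => ?_)
    have h := stageToAlg_hom g n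
    rw [stageToAlg_omegaAlgebra] at h
    exact h.trans
      (OmegaColimit.initInj_desc (stageToAlg B) (initChainMap_stageToAlg B) n).symm

variable {F} in
/-- The stages `Fⁿ0` cover the initial algebra. -/
theorem exists_stageToAlg_eq {M : Endofunctor.Algebra F} (hM : IsInitial M) (x : M.a) :
    ∃ n z, stageToAlg M n z = x := by
  let θ := (isInitialOmegaAlgebra F).uniqueUpToIso hM
  have hθ : θ.inv.f ≫ θ.hom.f = 𝟙 M.a := congrArg Endofunctor.Algebra.Hom.f θ.inv_hom_id
  obtain ⟨n, z, hz⟩ := Types.jointly_surjective' (θ.inv.f x)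
  refine ⟨n, z, ?_⟩
  have h := stageToAlg_hom θ.hom n
  rw [stageToAlg_omegaAlgebra] at h
  rw [← h]
  exact (congrArg θ.hom.f hz).trans (ConcreteCategory.congr_hom hθ x)

end InitialAlgebra

/-! ### Comparison of `μF`, `νF` and `F^ω 1` -/

section Comparison

variable {F : Type u ⥤ Type u} {M : Endofunctor.Algebra F} (hM : IsInitial M)
  {N : Endofunctor.Coalgebra F} (hN : IsTerminal N)

/-- `m` is a coalgebra homomorphism: `τ ∘ m = F m ∘ ι⁻¹`. -/
theorem muToNu_str : muToNu hM hN ≫ N.str = iotaInv hM ≫ F.map (muToNu hM hN) :=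
  (hN.from ⟨M.a, iotaInv hM⟩).h.symm

/-- The composite `h ∘ m` is an algebra homomorphism to `F^ω 1` with structure `limitStr F`, so its
restrictions to the stages satisfy the same recursion as `stageToLimit`. -/
theorem stageToAlg_muToNu_coalgToLimit (n : ℕ) :
    stageToAlg M n ≫ muToNu hM hN ≫ coalgToLimit N = stageToLimit F n := by
  have hhom : muToNu hM hN ≫ coalgToLimit N = coalgToLimit ⟨M.a, iotaInv hM⟩ :=
    hom_coalgToLimit (hN.from ⟨M.a, iotaInv hM⟩)
  have hstr : M.str ≫ muToNu hM hN ≫ coalgToLimit N =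
      F.map (muToNu hM hN ≫ coalgToLimit N) ≫ limitStr F := by
    rw [hhom, coalgToLimit_eq]
    change M.str ≫ iotaInv hM ≫ _ = _
    rw [← Category.assoc, Endofunctor.Algebra.Initial.right_inv, Category.id_comp,
      ← coalgToLimit_eq]
  induction n with
  | zero => ext x; exact x.elim
  | succ n ih =>
    change (F.map (stageToAlg M n) ≫ M.str) ≫ _ = _
    rw [Category.assoc, hstr, ← Category.assoc, ← F.map_comp, ih, stageToLimit_succ]

theorem coalgToLimit_muToNu_stageToAlg (n : ℕ) (z : initChain F n) :
    coalgToLimit N (muToNu hM hN (stageToAlg M n z)) = stageToLimit F n z :=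
  ConcreteCategory.congr_hom (stageToAlg_muToNu_coalgToLimit hM hN n) z

theorem exists_coalgToLimit_muToNu_eq_epsilon (p : F.obj PEmpty.{u + 1}) (n : ℕ)
    (s : OmegaLimit F) : ∃ x, coalgToLimit N (muToNu hM hN x) = epsilon F p n s :=
  ⟨stageToAlg M (n + 1) (iterPoint F p n (s.1 n)), by
    rw [coalgToLimit_muToNu_stageToAlg, epsilon_apply, eMap_apply]⟩

theorem exists_stageToAlg_eq_of_le {m n : ℕ} (hmn : m ≤ n) (z : initChain F m) :
    ∃ z', stageToAlg M n z' = stageToAlg M m z := by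
  induction n, hmn using Nat.le_induction with
  | base => exact ⟨z, rfl⟩
  | succ n _ ih =>
    obtain ⟨z', hz'⟩ := ih
    exact ⟨initChainMap F n z',
      (ConcreteCategory.congr_hom (initChainMap_stageToAlg M n) z').trans hz'⟩

/-- Lift both elements to a common stage `Fˡ0`. Equal images in `F^ω 1` agree under `Fˡ!`; applying
`Fˡp` turns this into agreement under `w_{l,l+1}`, hence in `μF`. -/
theorem coalgToLimit_muToNu_injective [PreservesFilteredColimits F] (p : F.obj PEmpty.{u + 1}) :
    Function.Injective fun x => coalgToLimit N (muToNu hM hN x) := by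
  intro x y hxy
  obtain ⟨n, z, rfl⟩ := exists_stageToAlg_eq hM x
  obtain ⟨k, w, rfl⟩ := exists_stageToAlg_eq hM y
  obtain ⟨z', hz'⟩ := exists_stageToAlg_eq_of_le (M := M) (le_max_left n k) z
  obtain ⟨w', hw'⟩ := exists_stageToAlg_eq_of_le (M := M) (le_max_right n k) w
  rw [← hz', ← hw'] at hxy ⊢
  generalize max n k = l at *
  simp only [coalgToLimit_muToNu_stageToAlg] at hxy
  have hcross : cross F l l z' = cross F l l w' := congrArg (fun t : OmegaLimit F => t.1 l) hxy
  have hmap : initChainMap F l z' = initChainMap F l w' := by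
    rw [← cross_iterPoint F p l]
    exact congrArg (iterPoint F p l) hcross
  rw [← initChainMap_stageToAlg]
  exact congrArg (stageToAlg M (l + 1)) hmap

end Comparison

theorem scottContinuous_of_orderIso {P Q : Type*} [PartialOrder P] [PartialOrder Q] (f : P ≃o Q) :
    ScottContinuous f := fun _ _ _ _ ha => f.isLUB_image'.2 ha

/-- Continuous maps which agree on a subposet containing all truncations are equal. -/
theorem IsTruncation.eq_of_scottContinuous {K : Type*} [PartialOrder K] {e : ℕ → K → K}
    (h : IsTruncation e) {P R Q : Type*} [PartialOrder P] [PartialOrder Q] {i : P → K}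
    (hi : ∀ x y, i x ≤ i y ↔ x ≤ y) {j : R → P} (hr : ∀ n s, ∃ x, i (j x) = e n s)
    {f g : P → Q} (hf : ScottContinuous f) (hg : ScottContinuous g)
    (hfg : ∀ x, f (j x) = g (j x)) (t : P) : f t = g t := by
  choose r hr using hr
  have hmono : Monotone fun n => j (r n (i t)) := fun n k hnk => by
    rw [← hi, hr, hr]
    exact h.monotone_index _ hnk
  -- The join is computed inside `P`, so neither `P` nor `Q` has to be a cpo.
  have hlub : IsLUB (Set.range fun n => j (r n (i t))) t := by
    refine ⟨?_, fun u hu => ?_⟩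
    · rintro _ ⟨n, rfl⟩
      rw [← hi, hr]
      exact h.apply_le n _
    · rw [← hi]
      refine h.le_of_forall_apply_le fun n => ?_
      rw [← hr, hi]
      exact hu ⟨n, rfl⟩
  have hdir := directedOn_range.2 (directed_of_isDirected_le hmono)
  have h1 := hf (Set.range_nonempty _) hdir hlub
  have h2 := hg (Set.range_nonempty _) hdir hlub
  have himg : f '' (Set.range fun n => j (r n (i t))) = g '' Set.range fun n => j (r n (i t)) :=
    Set.image_congr (by rintro _ ⟨n, rfl⟩; exact hfg _)
  rw [himg] at h1
  exact h1.unique h2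

end SetFunctor

/-! ### The main theorem -/

theorem theoremT4p12 (F : Type u ⥤ Type u) [PreservesFilteredColimits F]
    (p : F.obj PEmpty.{u + 1}) :
    HasInitial (Endofunctor.Algebra F) ∧ HasTerminal (Endofunctor.Coalgebra F) ∧
    ∀ (M : Endofunctor.Algebra F) (hM : IsInitial M)
      (N : Endofunctor.Coalgebra F) (hN : IsTerminal N),
      ∃ (_ : PartialOrder (SetFunctor.OmegaLimit F)) (_ : PartialOrder N.V)
        (_ : PartialOrder M.a) (_ : PartialOrder (F.obj N.V)) (_ : PartialOrder (F.obj M.a)),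
        -- the order of `F^ω 1`
        (∀ t s : SetFunctor.OmegaLimit F, t ≤ s ↔ t = s ∨ ∃ n, t = SetFunctor.epsilon F p n s) ∧
        -- `νF` is a subposet of `F^ω 1`, and `μF` is a subposet of `νF`
        (∀ t s : N.V, t ≤ s ↔ SetFunctor.coalgToLimit N t ≤ SetFunctor.coalgToLimit N s) ∧
        (∀ t s : M.a, t ≤ s ↔ SetFunctor.muToNu hM hN t ≤ SetFunctor.muToNu hM hN s) ∧
        -- the isomorphisms `τ` and `ι` transport the orders to `F(νF)` and `F(μF)`
        (∀ t s : N.V, N.str t ≤ N.str s ↔ t ≤ s) ∧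
        (∀ t s : F.obj M.a, M.str t ≤ M.str s ↔ t ≤ s) ∧
        -- `F^ω 1` is a conservative completion of both `μF` and `νF`
        SetFunctor.IsConservativeCompletion
          (fun t : M.a => SetFunctor.coalgToLimit N (SetFunctor.muToNu hM hN t)) ∧
        SetFunctor.IsConservativeCompletion (fun t : N.V => SetFunctor.coalgToLimit N t) ∧
        -- `F(μF)` is a subposet of `F(νF)`, and `ι⁻¹` is continuous
        (∀ t s : F.obj M.a,
          F.map (SetFunctor.muToNu hM hN) t ≤ F.map (SetFunctor.muToNu hM hN) s ↔ t ≤ s) ∧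
        ScottContinuous (fun t : M.a => SetFunctor.iotaInv hM t) ∧
        -- `τ` is the unique continuous extension of `ι⁻¹`
        ScottContinuous (fun t : N.V => N.str t) ∧
        (∀ t : M.a, N.str (SetFunctor.muToNu hM hN t) =
          F.map (SetFunctor.muToNu hM hN) (SetFunctor.iotaInv hM t)) ∧
        ∀ g : N.V → F.obj N.V, ScottContinuous g →
          (∀ t : M.a, g (SetFunctor.muToNu hM hN t) =
            F.map (SetFunctor.muToNu hM hN) (SetFunctor.iotaInv hM t)) →
          ∀ t : N.V, g t = N.str t := by
  refine ⟨(SetFunctor.isInitialOmegaAlgebra F).hasInitial,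
    (SetFunctor.isTerminalBehaviourCoalgebra F).hasTerminal, fun M hM N hN => ?_⟩
  have hinj := SetFunctor.coalgToLimit_muToNu_injective hM hN p
  have htr := SetFunctor.isTruncation_epsilon F p
  have hrange := SetFunctor.exists_coalgToLimit_muToNu_eq_epsilon hM hN p
  have hleft : ∀ t, M.str (SetFunctor.iotaInv hM t) = t :=
    ConcreteCategory.congr_hom (Endofunctor.Algebra.Initial.left_inv hM)
  have hright : ∀ t, SetFunctor.iotaInv hM (M.str t) = t :=
    ConcreteCategory.congr_hom (Endofunctor.Algebra.Initial.right_inv hM)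
  have hleft' : ∀ t, Endofunctor.Coalgebra.Terminal.strInv hN (N.str t) = t :=
    ConcreteCategory.congr_hom (Endofunctor.Coalgebra.Terminal.right_inv hN)
  have hright' : ∀ t, N.str (Endofunctor.Coalgebra.Terminal.strInv hN t) = t :=
    ConcreteCategory.congr_hom (Endofunctor.Coalgebra.Terminal.left_inv hN)
  have hm : ∀ t, N.str (SetFunctor.muToNu hM hN t) =
      F.map (SetFunctor.muToNu hM hN) (SetFunctor.iotaInv hM t) :=
    ConcreteCategory.congr_hom (SetFunctor.muToNu_str hM hN)
  let oL := SetFunctor.omegaLimitOrder F p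
  let oN : PartialOrder N.V :=
    PartialOrder.lift (SetFunctor.coalgToLimit N) (SetFunctor.coalgToLimit_injective hN)
  let oM : PartialOrder M.a :=
    PartialOrder.lift (fun x => SetFunctor.coalgToLimit N (SetFunctor.muToNu hM hN x)) hinj
  let oFN : PartialOrder (F.obj N.V) :=
    PartialOrder.lift (Endofunctor.Coalgebra.Terminal.strInv hN)
      (Function.LeftInverse.injective hright')
  let oFM : PartialOrder (F.obj M.a) :=
    PartialOrder.lift M.str (Function.LeftInverse.injective hright)
  have hτ : ∀ t s : N.V, N.str t ≤ N.str s ↔ t ≤ s := fun t s => by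
    change Endofunctor.Coalgebra.Terminal.strInv hN (N.str t) ≤
      Endofunctor.Coalgebra.Terminal.strInv hN (N.str s) ↔ t ≤ s
    rw [hleft', hleft']
  have hι : ∀ t s : M.a, SetFunctor.iotaInv hM t ≤ SetFunctor.iotaInv hM s ↔ t ≤ s :=
    fun t s => by
      change M.str (SetFunctor.iotaInv hM t) ≤ M.str (SetFunctor.iotaInv hM s) ↔ t ≤ s
      rw [hleft, hleft]
  have hτcont : ScottContinuous fun t : N.V => N.str t :=
    SetFunctor.scottContinuous_of_orderIso
      ⟨⟨N.str, Endofunctor.Coalgebra.Terminal.strInv hN, hleft', hright'⟩, hτ _ _⟩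
  refine ⟨oL, oN, oM, oFN, oFM, fun t s => Iff.rfl, fun t s => Iff.rfl, fun t s => Iff.rfl, hτ,
    fun t s => Iff.rfl, htr.isConservativeCompletion (fun _ _ => Iff.rfl) hrange,
    htr.isConservativeCompletion (fun _ _ => Iff.rfl) fun n s => ?_, fun t s => ?_,
    SetFunctor.scottContinuous_of_orderIso
      ⟨⟨SetFunctor.iotaInv hM, M.str, hleft, hright⟩, hι _ _⟩,
    hτcont, hm, fun g hg hgm t => ?_⟩
  · obtain ⟨x, hx⟩ := hrange n s
    exact ⟨_, hx⟩
  · rw [← hright t, ← hright s, ← hm, ← hm, hτ, hι]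
    exact Iff.rfl
  · exact htr.eq_of_scottContinuous (i := fun x : N.V => SetFunctor.coalgToLimit N x)
      (fun _ _ => Iff.rfl) hrange hg hτcont (fun x => (hgm x).trans (hm x).symm) t
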